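/- For a convex polytope $P\subset\mathbb R^d$ and $c\in\mathbb R^d$ let $S(P;c)=\{x\in P:\langle x,c\rangle=\max_{y\in P}\langle y,c\rangle\}$; the nonempty faces of $P$ are the sets $S(P;c)$, $c\in\mathbb R^d$. The outer normal cone of $P$ at a nonempty face $F$ is $\mathcal N(F;P)=\{c\in\mathbb R^d: F=S(P;c)\}$, and $P$ is called perfectly centered if $\operatorname{relint}(F)\cap\mathcal N(F;P)\neq\emptyset$ for every nonempty face $F$ of $P$ (including $F=P$). The dual of $P$ is $P^*=\{x\in\mathbb R^d:\langle x,y\rangle\le 1\text{ for all }y\in P\}$, a Nesterov rounding of $P$ is a Minkowski sum $P+\alpha P^*$ with $\alpha>0$, and $f_k$ denotes the number of nonempty faces of dimension $k$. **Theorem.** Let $\Delta_d\subset\mathbb R^d$ be a perfectly centered (full-dimensional) $d$-simplex. Then for every $\alpha>0$ and every integer $k$ with $0\le k\le d-1$, $$f_k(\Delta_d+\alpha\Delta_d^*)=\binom{d+1}{k+2}\left(2^{k+2}-2\right).$$ In particular, $f_k(\Delta_d+\Delta_d^*)=\binom{d+1}{k+2}\left(2^{k+2}-2\right)$. -/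

import Mathlib

open scoped Pointwise

/-- The set `S(P;c)` of maximizers over `P` of the linear function `⟨·, c⟩`. -/
def supportFace {d : ℕ} (P : Set (EuclideanSpace ℝ (Fin d))) (c : EuclideanSpace ℝ (Fin d)) :
    Set (EuclideanSpace ℝ (Fin d)) :=
  {x ∈ P | ∀ y ∈ P, inner ℝ y c ≤ inner ℝ x c}

/-- A nonempty face of a polytope `P`: a nonempty set of maximizers over `P` of some linear
function. The zero function gives `P` itself. -/
def IsNonemptyFace {d : ℕ} (P F : Set (EuclideanSpace ℝ (Fin d))) : Prop :=
  F.Nonempty ∧ ∃ c : EuclideanSpace ℝ (Fin d), F = supportFace P c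

/-- The outer normal cone `N(F;P)` of `P` at a face `F`: all `c` with `F = S(P;c)`. -/
def outerNormalCone {d : ℕ} (F P : Set (EuclideanSpace ℝ (Fin d))) :
    Set (EuclideanSpace ℝ (Fin d)) :=
  {c | F = supportFace P c}

/-- A polytope is perfectly centered if the relative interior of each of its nonempty faces meets
the outer normal cone of that face. -/
def IsPerfectlyCentered {d : ℕ} (P : Set (EuclideanSpace ℝ (Fin d))) : Prop :=
  ∀ F, IsNonemptyFace P F → (intrinsicInterior ℝ F ∩ outerNormalCone F P).Nonempty

/-- The dual `P* = {x | ⟨x, y⟩ ≤ 1 for all y ∈ P}`. -/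
def dualBody {d : ℕ} (P : Set (EuclideanSpace ℝ (Fin d))) : Set (EuclideanSpace ℝ (Fin d)) :=
  {x | ∀ y ∈ P, inner ℝ x y ≤ 1}

/-- The Nesterov rounding `P + α P*` (Minkowski sum) with scaling factor `α`. -/
def nesterovRounding {d : ℕ} (α : ℝ) (P : Set (EuclideanSpace ℝ (Fin d))) :
    Set (EuclideanSpace ℝ (Fin d)) :=
  P + α • dualBody P

/-- The number `f_k(P)` of `k`-dimensional (nonempty) faces of `P`, the dimension of a face being
that of its affine span. -/
noncomputable def faceCount {d : ℕ} (k : ℕ) (P : Set (EuclideanSpace ℝ (Fin d))) : ℕ :=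
  {F | IsNonemptyFace P F ∧ Module.finrank ℝ (vectorSpan ℝ F) = k}.ncard

/-! ### Faces and direction spaces of Minkowski sums. -/

section Generic

variable {d : ℕ} {P Q : Set (EuclideanSpace ℝ (Fin d))} {c : EuclideanSpace ℝ (Fin d)}

/-! Write `P` for the simplex. The origin is interior to it, so every `c` is a nonnegative
combination of vertices with support a proper subset `E`. By complementary slackness `c` exposes the
face `dualFace b E` of the dual, while on `P` it exposes the hull of the vertices in `A = maximizers
b c`. Maximizing sets of a Minkowski sum add, so for `E` nonempty everything depends on which pairs
`(A, E)` occur.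

Perfect centering forces `A ⊆ E` (`maximizers_sum_smul_subset`), and conversely realizes every pair
with `∅ ≠ A ⊆ E` and `E` proper (`exists_supportFace_eq`). Distinct pairs give distinct faces. The
two summands have orthogonal directions, so the dimension is `(|A| - 1) + (d - |E|)`. Setting `C = A
∪ Eᶜ`, this equals `k` exactly when `|C| = k + 2`. A face is thus a `(k + 2)`-set `C` of vertices
with a nonempty proper subset `A`. -/

theorem add_mem_supportFace_add_iff {x y : EuclideanSpace ℝ (Fin d)} (hx : x ∈ P) (hy : y ∈ Q) :
    x + y ∈ supportFace (P + Q) c ↔ x ∈ supportFace P c ∧ y ∈ supportFace Q c := by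
  constructor
  · rintro ⟨-, h⟩
    refine ⟨⟨hx, fun z hz => ?_⟩, ⟨hy, fun z hz => ?_⟩⟩
    · simpa [inner_add_left] using h (z + y) (Set.add_mem_add hz hy)
    · simpa [inner_add_left] using h (x + z) (Set.add_mem_add hx hz)
  · rintro ⟨⟨-, h₁⟩, ⟨-, h₂⟩⟩
    refine ⟨Set.add_mem_add hx hy, ?_⟩
    rintro _ ⟨z, hz, w, hw, rfl⟩
    simpa [inner_add_left] using add_le_add (h₁ z hz) (h₂ w hw)

theorem supportFace_add (P Q : Set (EuclideanSpace ℝ (Fin d))) (c : EuclideanSpace ℝ (Fin d)) :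
    supportFace (P + Q) c = supportFace P c + supportFace Q c := by
  ext z
  constructor
  · intro hz
    obtain ⟨x, hx, y, hy, rfl⟩ := hz.1
    have := (add_mem_supportFace_add_iff hx hy).1 hz
    exact Set.add_mem_add this.1 this.2
  · rintro ⟨x, hx, y, hy, rfl⟩
    exact (add_mem_supportFace_add_iff hx.1 hy.1).2 ⟨hx, hy⟩

theorem supportFace_smul {α : ℝ} (hα : 0 < α) (P : Set (EuclideanSpace ℝ (Fin d)))
    (c : EuclideanSpace ℝ (Fin d)) : supportFace (α • P) c = α • supportFace P c := by
  ext z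
  constructor
  · rintro ⟨⟨x, hx, rfl⟩, h⟩
    refine ⟨x, ⟨hx, fun y hy => ?_⟩, rfl⟩
    have := h (α • y) (Set.smul_mem_smul_set hy)
    simp only [real_inner_smul_left] at this
    exact le_of_mul_le_mul_left this hα
  · rintro ⟨x, ⟨hx, h⟩, rfl⟩
    refine ⟨Set.smul_mem_smul_set hx, ?_⟩
    rintro _ ⟨y, hy, rfl⟩
    simp only [real_inner_smul_left]
    exact mul_le_mul_of_nonneg_left (h y hy) hα.le

/-- A face of a Minkowski sum determines its summands. -/
theorem supportFace_eq_of_supportFace_add_eq {c' : EuclideanSpace ℝ (Fin d)}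
    (hP : (supportFace P c).Nonempty) (hQ : (supportFace Q c).Nonempty)
    (h : supportFace (P + Q) c ⊆ supportFace (P + Q) c') :
    supportFace P c ⊆ supportFace P c' ∧ supportFace Q c ⊆ supportFace Q c' := by
  obtain ⟨p, hp⟩ := hP
  obtain ⟨q, hq⟩ := hQ
  refine ⟨fun x hx => ?_, fun y hy => ?_⟩
  · exact ((add_mem_supportFace_add_iff hx.1 hq.1).1
      (h ((add_mem_supportFace_add_iff hx.1 hq.1).2 ⟨hx, hq⟩))).1
  · exact ((add_mem_supportFace_add_iff hp.1 hy.1).1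
      (h ((add_mem_supportFace_add_iff hp.1 hy.1).2 ⟨hp, hy⟩))).2

theorem vectorSpan_add_set {V : Type*} [AddCommGroup V] [Module ℝ V] {s t : Set V}
    (hs : s.Nonempty) (ht : t.Nonempty) :
    vectorSpan ℝ (s + t) = vectorSpan ℝ s ⊔ vectorSpan ℝ t := by
  apply le_antisymm
  · rw [vectorSpan_def, Submodule.span_le]
    rintro _ ⟨_, ⟨x, hx, y, hy, rfl⟩, _, ⟨z, hz, w, hw, rfl⟩, rfl⟩
    have : (x + y) -ᵥ (z + w) = (x -ᵥ z) + (y -ᵥ w) := by simp only [vsub_eq_sub]; abel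
    change (x + y) -ᵥ (z + w) ∈ _
    rw [this]
    exact Submodule.add_mem_sup (vsub_mem_vectorSpan ℝ hx hz) (vsub_mem_vectorSpan ℝ hy hw)
  · obtain ⟨p, hp⟩ := hs
    obtain ⟨q, hq⟩ := ht
    refine sup_le ?_ ?_ <;> rw [vectorSpan_def, Submodule.span_le]
    · rintro _ ⟨x, hx, y, hy, rfl⟩
      simpa using vsub_mem_vectorSpan ℝ (Set.add_mem_add hx hq) (Set.add_mem_add hy hq)
    · rintro _ ⟨x, hx, y, hy, rfl⟩
      simpa using vsub_mem_vectorSpan ℝ (Set.add_mem_add hp hx) (Set.add_mem_add hp hy)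

theorem vectorSpan_smul_set {V : Type*} [AddCommGroup V] [Module ℝ V] {α : ℝ} (hα : α ≠ 0)
    (s : Set V) : vectorSpan ℝ (α • s) = vectorSpan ℝ s := by
  apply le_antisymm <;> rw [vectorSpan_def, Submodule.span_le]
  · rintro _ ⟨_, ⟨x, hx, rfl⟩, _, ⟨y, hy, rfl⟩, rfl⟩
    simpa [smul_sub] using Submodule.smul_mem _ α (vsub_mem_vectorSpan ℝ hx hy)
  · rintro _ ⟨x, hx, y, hy, rfl⟩
    have := Submodule.smul_mem _ α⁻¹
      (vsub_mem_vectorSpan ℝ (Set.smul_mem_smul_set (a := α) hx) (Set.smul_mem_smul_set hy))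
    simpa [← smul_sub, smul_smul, hα] using this

theorem vectorSpan_convexHull {V : Type*} [AddCommGroup V] [Module ℝ V] (s : Set V) :
    vectorSpan ℝ (convexHull ℝ s) = vectorSpan ℝ s := by
  rw [← direction_affineSpan, affineSpan_convexHull, direction_affineSpan]

/-- A point of the relative interior can be pushed away from any other point of the set. -/
theorem exists_pos_lineMap_mem_of_mem_intrinsicInterior {V : Type*} [NormedAddCommGroup V]
    [NormedSpace ℝ V] {s : Set V} {p q : V} (hp : p ∈ intrinsicInterior ℝ s) (hq : q ∈ s) :
    ∃ ε : ℝ, 0 < ε ∧ AffineMap.lineMap p q (-ε) ∈ s := by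
  obtain ⟨y, hy, rfl⟩ := mem_intrinsicInterior.1 hp
  have hq' := subset_affineSpan ℝ s hq
  let f : ℝ → affineSpan ℝ s := fun t =>
    ⟨AffineMap.lineMap (y : V) q (-t), AffineMap.lineMap_mem _ y.2 hq'⟩
  have hf : Continuous f := by
    refine Continuous.subtype_mk ?_ _
    simp only [AffineMap.lineMap_apply]
    fun_prop
  have h0 : f 0 = y := Subtype.ext (by simp [f])
  have hev : ∀ᶠ t in nhds (0 : ℝ), f t ∈ ((↑) ⁻¹' s : Set (affineSpan ℝ s)) :=
    hf.continuousAt.eventually (by rw [h0]; exact mem_interior_iff_mem_nhds.1 hy)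
  obtain ⟨ε, hε, hpos⟩ := ((hev.filter_mono nhdsWithin_le_nhds).and
    (self_mem_nhdsWithin (a := (0 : ℝ)) (s := Set.Ioi 0))).exists
  exact ⟨ε, hpos, hε⟩

end Generic

/-! ### Faces of a simplex in barycentric coordinates; centers of faces. -/

section Simplex

variable {d : ℕ} {ι : Type*} [Fintype ι]

/-- The indices at which a linear function is maximal over a finite family of points. -/
noncomputable def maximizers (v : ι → EuclideanSpace ℝ (Fin d)) (c : EuclideanSpace ℝ (Fin d)) :
    Finset ι :=
  open Classical in {i | ∀ j, inner ℝ (v j) c ≤ inner ℝ (v i) c}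

theorem mem_maximizers {v : ι → EuclideanSpace ℝ (Fin d)} {c : EuclideanSpace ℝ (Fin d)} {i : ι} :
    i ∈ maximizers v c ↔ ∀ j, inner ℝ (v j) c ≤ inner ℝ (v i) c := by
  simp [maximizers]

theorem maximizers_nonempty [Nonempty ι] (v : ι → EuclideanSpace ℝ (Fin d))
    (c : EuclideanSpace ℝ (Fin d)) : (maximizers v c).Nonempty := by
  obtain ⟨i, hi⟩ := Finite.exists_max fun i => inner ℝ (v i) c
  exact ⟨i, mem_maximizers.2 hi⟩

/-- A common maximizer attains both maxima at once, so any maximizer of the positive combination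
must attain both as well. -/
theorem maximizers_smul_add [DecidableEq ι] (v : ι → EuclideanSpace ℝ (Fin d)) {t : ℝ} (ht : 0 < t)
    (x y : EuclideanSpace ℝ (Fin d)) (h : (maximizers v x ∩ maximizers v y).Nonempty) :
    maximizers v (t • x + y) = maximizers v x ∩ maximizers v y := by
  obtain ⟨i, hi⟩ := h
  obtain ⟨hx, hy⟩ := Finset.mem_inter.1 hi
  rw [mem_maximizers] at hx hy
  ext k
  simp only [Finset.mem_inter, mem_maximizers, inner_add_right, real_inner_smul_right]
  constructor
  · intro h
    have hk := h i
    have h₁ := mul_le_mul_of_nonneg_left (hx k) ht.le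
    refine ⟨fun j => (hx j).trans ?_, fun j => (hy j).trans ?_⟩
    · exact le_of_mul_le_mul_left (by linarith [hy k]) ht
    · linarith
  · rintro ⟨h₁, h₂⟩ j
    exact add_le_add (mul_le_mul_of_nonneg_left (h₁ j) ht.le) (h₂ j)

variable (b : AffineBasis ι ℝ (EuclideanSpace ℝ (Fin d)))

theorem AffineBasis.mem_convexHull_image_iff (A : Finset ι) (x : EuclideanSpace ℝ (Fin d)) :
    x ∈ convexHull ℝ (b '' A) ↔ (∀ i, 0 ≤ b.coord i x) ∧ ∀ i ∉ A, b.coord i x = 0 := by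
  constructor
  · intro hx
    refine ⟨?_, fun i hi => ?_⟩
    · have := convexHull_mono (Set.image_subset_range b A) hx
      rwa [b.convexHull_eq_nonneg_coord] at this
    · have hconv : Convex ℝ (b.coord i ⁻¹' {0}) := (convex_singleton 0).affine_preimage _
      refine convexHull_min ?_ hconv hx
      rintro _ ⟨j, hj, rfl⟩
      exact b.coord_apply_ne (fun h => hi (h ▸ hj))
  · rintro ⟨h₁, h₂⟩
    have hs : ∑ i ∈ A, b.coord i x = 1 := by
      rw [← b.sum_coord_apply_eq_one x]
      exact Finset.sum_subset (Finset.subset_univ _) fun i _ hi => h₂ i hi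
    have hx : ∑ i ∈ A, b.coord i x • b i = x := by
      refine Eq.trans ?_ (b.linear_combination_coord_eq_self x)
      exact Finset.sum_subset (Finset.subset_univ _) fun i _ hi => by simp [h₂ i hi]
    rw [← hx]
    exact (convex_convexHull ℝ _).sum_mem (fun i _ => h₁ i) hs
      fun i hi => subset_convexHull ℝ _ ⟨i, hi, rfl⟩

theorem AffineBasis.mem_convexHull_image_apply_iff (A : Finset ι) (i : ι) :
    b i ∈ convexHull ℝ (b '' A) ↔ i ∈ A := by
  refine ⟨fun h => ?_, fun h => subset_convexHull ℝ _ ⟨i, h, rfl⟩⟩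
  by_contra hi
  have := ((b.mem_convexHull_image_iff A _).1 h).2 i hi
  simp at this

theorem AffineBasis.inner_eq_sum_coord (x c : EuclideanSpace ℝ (Fin d)) :
    inner ℝ x c = ∑ i, b.coord i x * inner ℝ (b i) c := by
  conv_lhs => rw [← b.linear_combination_coord_eq_self x, sum_inner]
  simp only [real_inner_smul_left]

theorem AffineBasis.inner_le_of_mem_maximizers {x c : EuclideanSpace ℝ (Fin d)}
    (hx : ∀ i, 0 ≤ b.coord i x) {i : ι} (hi : i ∈ maximizers b c) :
    inner ℝ x c ≤ inner ℝ (b i) c := by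
  rw [b.inner_eq_sum_coord, ← one_mul (inner ℝ (b i) c), ← b.sum_coord_apply_eq_one x,
    Finset.sum_mul]
  exact Finset.sum_le_sum fun j _ => mul_le_mul_of_nonneg_left (mem_maximizers.1 hi j) (hx j)

theorem AffineBasis.supportFace_convexHull_range (c : EuclideanSpace ℝ (Fin d)) :
    supportFace (convexHull ℝ (Set.range b)) c = convexHull ℝ (b '' maximizers b c) := by
  have := b.nonempty
  obtain ⟨i, hi⟩ := maximizers_nonempty b c
  ext x
  rw [b.mem_convexHull_image_iff]
  constructor
  · rintro ⟨hx, h⟩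
    have hx' : ∀ i, 0 ≤ b.coord i x := by rwa [b.convexHull_eq_nonneg_coord] at hx
    refine ⟨hx', fun k hk => ?_⟩
    have h₁ := h _ (subset_convexHull ℝ _ ⟨i, rfl⟩)
    have h₂ : ∑ j, b.coord j x * (inner ℝ (b i) c - inner ℝ (b j) c) ≤ 0 := by
      simp only [mul_sub, Finset.sum_sub_distrib, ← Finset.sum_mul, b.sum_coord_apply_eq_one,
        ← b.inner_eq_sum_coord]
      linarith
    have h₃ : ∀ j ∈ Finset.univ, 0 ≤ b.coord j x * (inner ℝ (b i) c - inner ℝ (b j) c) :=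
      fun j _ => mul_nonneg (hx' j) (sub_nonneg.2 (mem_maximizers.1 hi j))
    have h₄ := (Finset.sum_eq_zero_iff_of_nonneg h₃).1 (le_antisymm h₂ (Finset.sum_nonneg h₃)) k
      (Finset.mem_univ k)
    rcases mul_eq_zero.1 h₄ with h₄ | h₄
    · exact h₄
    · refine absurd (mem_maximizers.2 fun j => ?_) hk
      rw [← sub_eq_zero.1 h₄]
      exact mem_maximizers.1 hi j
  · rintro ⟨hx, hA⟩
    refine ⟨by rwa [b.convexHull_eq_nonneg_coord], fun y hy => ?_⟩
    rw [b.convexHull_eq_nonneg_coord] at hy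
    refine (b.inner_le_of_mem_maximizers hy hi).trans_eq ?_
    rw [b.inner_eq_sum_coord x, ← one_mul (inner ℝ (b i) c), ← b.sum_coord_apply_eq_one x,
      Finset.sum_mul]
    refine Finset.sum_congr rfl fun j _ => ?_
    by_cases hj : j ∈ maximizers b c
    · rw [le_antisymm (mem_maximizers.1 hj i) (mem_maximizers.1 hi j)]
    · simp [hA j hj]

/-- Any values on an affine basis extend to an affine function; `c` represents its linear part and
`t` absorbs the constant. -/
theorem AffineBasis.exists_inner_eq_add (f : ι → ℝ) :
    ∃ (c : EuclideanSpace ℝ (Fin d)) (t : ℝ), ∀ i, inner ℝ (b i) c = f i + t := by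
  classical
  let g : EuclideanSpace ℝ (Fin d) →ₗ[ℝ] ℝ := ∑ i, f i • (b.coord i).linear
  refine ⟨(InnerProductSpace.toDual ℝ _).symm g.toContinuousLinearMap,
    -∑ i, f i * b.coord i 0, fun j => ?_⟩
  rw [real_inner_comm, InnerProductSpace.toDual_symm_apply]
  have h : ∀ i, (b.coord i).linear (b j) = (if i = j then 1 else 0) - b.coord i 0 := by
    intro i
    rw [← b.coord_apply i j]
    have := (b.coord i).linearMap_vsub (b j) 0
    simpa using this
  simp only [g, LinearMap.coe_toContinuousLinearMap', LinearMap.sum_apply, LinearMap.smul_apply,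
    h, smul_eq_mul, mul_sub, Finset.sum_sub_distrib]
  simp [sub_eq_add_neg]

/-- The values of a linear function on the
vertices can be prescribed subject to the one linear relation among the vertices. -/
theorem AffineBasis.exists_inner_eq {f : ι → ℝ} (hf : ∑ i, b.coord i 0 * f i = 0) :
    ∃ c : EuclideanSpace ℝ (Fin d), ∀ i, inner ℝ (b i) c = f i := by
  obtain ⟨c, t, h⟩ := b.exists_inner_eq_add f
  have h0 := b.inner_eq_sum_coord 0 c
  simp only [inner_zero_left, h, mul_add, Finset.sum_add_distrib, hf, ← Finset.sum_mul,
    b.sum_coord_apply_eq_one, zero_add, one_mul] at h0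
  exact ⟨c, fun i => by rw [h, ← h0, add_zero]⟩

theorem AffineBasis.exists_maximizers_eq {A : Finset ι} (hA : A.Nonempty) :
    ∃ c, maximizers b c = A := by
  classical
  obtain ⟨c, t, h⟩ := b.exists_inner_eq_add fun i => if i ∈ A then 1 else 0
  obtain ⟨a, ha⟩ := hA
  refine ⟨c, Finset.ext fun i => ?_⟩
  simp only [mem_maximizers, h, add_le_add_iff_right]
  constructor
  · intro hi
    by_contra hiA
    have := hi a
    simp only [ha, hiA, if_true, if_false] at this
    linarith
  · intro hi j
    simp only [hi, if_true]
    split_ifs <;> norm_num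

/-- Perfect centering in coordinates, the only form used later: `p` is relatively interior to the
face `A` and also exposes it. -/
theorem AffineBasis.exists_center_of_isPerfectlyCentered
    (hb : IsPerfectlyCentered (convexHull ℝ (Set.range b))) {A : Finset ι} (hA : A.Nonempty) :
    ∃ p, (∀ i, 0 ≤ b.coord i p) ∧ (∀ i, b.coord i p ≠ 0 ↔ i ∈ A) ∧ maximizers b p = A := by
  obtain ⟨c, hc⟩ := b.exists_maximizers_eq hA
  have hne : (convexHull ℝ (b '' (A : Set ι))).Nonempty := by
    obtain ⟨a, ha⟩ := hA
    exact ⟨b a, subset_convexHull ℝ _ ⟨a, ha, rfl⟩⟩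
  obtain ⟨p, hp, hN⟩ := hb (convexHull ℝ (b '' A))
    ⟨hne, c, by rw [b.supportFace_convexHull_range, hc]⟩
  have hpF := (b.mem_convexHull_image_iff A p).1 (intrinsicInterior_subset hp)
  refine ⟨p, hpF.1, fun i => ⟨fun h => ?_, fun hi h => ?_⟩, ?_⟩
  · by_contra hi
    exact h (hpF.2 i hi)
  -- If coordinate `i` vanished at `p`, moving away from `b i` would make it `-ε` while staying in
  -- the face.
  · obtain ⟨ε, hε, hmem⟩ := exists_pos_lineMap_mem_of_mem_intrinsicInterior hp
      (subset_convexHull ℝ (b '' A) ⟨i, hi, rfl⟩)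
    have := ((b.mem_convexHull_image_iff A _).1 hmem).1 i
    rw [AffineMap.apply_lineMap, h, b.coord_apply_eq] at this
    simp [AffineMap.lineMap_apply] at this
    linarith
  · ext i
    have hN' : convexHull ℝ (b '' A) = convexHull ℝ (b '' maximizers b p) := by
      rw [← b.supportFace_convexHull_range]
      exact hN
    rw [← b.mem_convexHull_image_apply_iff, ← hN', b.mem_convexHull_image_apply_iff]

/-- The center of the whole simplex is constant as a linear function on the vertices, hence
everywhere, so it is the origin. -/
theorem AffineBasis.coord_zero_pos_of_isPerfectlyCentered
    (hb : IsPerfectlyCentered (convexHull ℝ (Set.range b))) (i : ι) : 0 < b.coord i 0 := by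
  obtain ⟨p, h₀, h₁, h₂⟩ := b.exists_center_of_isPerfectlyCentered hb
    (A := Finset.univ) ⟨i, Finset.mem_univ i⟩
  have hconst : ∀ j, inner ℝ (b j) p = inner ℝ (b i) p := fun j =>
    le_antisymm (mem_maximizers.1 (h₂ ▸ Finset.mem_univ i) j)
      (mem_maximizers.1 (h₂ ▸ Finset.mem_univ j) i)
  have hall : ∀ x, inner ℝ x p = inner ℝ (b i) p := fun x => by
    simp [b.inner_eq_sum_coord x, hconst, ← Finset.sum_mul]
  have hp : p = 0 := by
    have := hall p
    rw [← hall 0, inner_zero_left] at this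
    exact inner_self_eq_zero.1 this
  subst hp
  exact lt_of_le_of_ne (h₀ i) (Ne.symm ((h₁ i).2 (Finset.mem_univ i)))

end Simplex

/-! ### Faces of the dual and of the rounding, indexed by vertex sets. -/

section Centered

variable {d : ℕ} {ι : Type*} [Fintype ι] (b : AffineBasis ι ℝ (EuclideanSpace ℝ (Fin d)))

/-- A linear function in the cone over a face of a perfectly centered simplex attains its maximum
only at vertices of that face. -/
theorem AffineBasis.maximizers_sum_smul_subset
    (hb : IsPerfectlyCentered (convexHull ℝ (Set.range b))) (E : Finset ι) (hE : E.Nonempty)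
    (μ : ι → ℝ) (h₀ : ∀ i, 0 ≤ μ i) (hμ : ∀ i, μ i ≠ 0 ↔ i ∈ E) :
    maximizers b (∑ i, μ i • b i) ⊆ E := by
  classical
  induction E using Finset.strongInduction generalizing μ with
  | H E ih =>
    obtain ⟨p, hp₀, hp, hmax⟩ := b.exists_center_of_isPerfectlyCentered hb hE
    -- The minimal ratio gives the largest multiple of the center `p` that can be removed with
    -- coefficients staying nonnegative. It kills index `k`, so induction applies to the remainder,
    -- whose maximizers then meet `E = maximizers b p`.
    obtain ⟨k, hk, hmin⟩ := E.exists_min_image (fun i => μ i / b.coord i p) hE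
    have hpos : ∀ i ∈ E, 0 < b.coord i p := fun i hi =>
      lt_of_le_of_ne (hp₀ i) (Ne.symm ((hp i).2 hi))
    set t := μ k / b.coord k p with ht
    have ht0 : 0 < t := div_pos (lt_of_le_of_ne (h₀ k) (Ne.symm ((hμ k).2 hk))) (hpos k hk)
    have hoff : ∀ i ∉ E, μ i - t * b.coord i p = 0 := fun i hi => by
      rw [not_not.1 (mt (hμ i).1 hi), not_not.1 (mt (hp i).1 hi)]
      simp
    have hsum : ∑ i, μ i • b i = t • p + ∑ i, (μ i - t * b.coord i p) • b i := by
      simp only [sub_smul, mul_smul, Finset.sum_sub_distrib, ← Finset.smul_sum,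
        b.linear_combination_coord_eq_self]
      abel
    have hint : (maximizers b p ∩
        maximizers b (∑ i, (μ i - t * b.coord i p) • b i)).Nonempty := by
      have := b.nonempty
      rw [hmax]
      by_cases hE' : (E.filter fun i => μ i - t * b.coord i p ≠ 0).Nonempty
      · have hsub := ih (E.filter fun i => μ i - t * b.coord i p ≠ 0) (by
          refine Finset.filter_ssubset.2 ⟨k, hk, ?_⟩
          simp [ht, (hpos k hk).ne']) hE' (fun i => μ i - t * b.coord i p) (fun i => by
          by_cases hi : i ∈ E
          · exact sub_nonneg.2 ((le_div_iff₀ (hpos i hi)).1 (hmin i hi))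
          · exact (hoff i hi).ge) (fun i => by
          simp only [Finset.mem_filter]
          exact ⟨fun h => ⟨by_contra fun hi => h (hoff i hi), h⟩, And.right⟩)
        obtain ⟨i, hi⟩ := maximizers_nonempty b (∑ i, (μ i - t * b.coord i p) • b i)
        exact ⟨i, Finset.mem_inter.2 ⟨Finset.filter_subset _ _ (hsub hi), hi⟩⟩
      · have hz : ∑ i, (μ i - t * b.coord i p) • b i = 0 := by
          refine Finset.sum_eq_zero fun i _ => ?_
          by_cases hi : i ∈ E
          · have : μ i - t * b.coord i p = 0 := by
              by_contra h
              exact hE' ⟨i, Finset.mem_filter.2 ⟨hi, h⟩⟩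
            rw [this, zero_smul]
          · rw [hoff i hi, zero_smul]
        exact ⟨k, Finset.mem_inter.2 ⟨hk, by simp [hz, mem_maximizers]⟩⟩
    rw [hsum, maximizers_smul_add _ ht0 _ _ hint, hmax]
    exact Finset.inter_subset_left

/-- If the origin is interior to a simplex, each point lies in the cone over a proper face. -/
theorem AffineBasis.exists_conic_combination (hpos : ∀ i, 0 < b.coord i 0)
    (c : EuclideanSpace ℝ (Fin d)) :
    ∃ (E : Finset ι) (μ : ι → ℝ), E ≠ Finset.univ ∧ (∀ i, 0 ≤ μ i) ∧
      (∀ i, μ i ≠ 0 ↔ i ∈ E) ∧ c = ∑ i, μ i • b i := by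
  classical
  have := b.nonempty
  -- Subtracting a multiple of the relation `∑ i, b.coord i 0 • b i = 0` leaves the point unchanged;
  -- the minimal ratio makes coefficient `k` vanish and keeps the others nonnegative.
  obtain ⟨k, hk⟩ := Finite.exists_min fun i => b.coord i c / b.coord i 0
  refine ⟨Finset.univ.filter fun i =>
      b.coord i c - b.coord k c / b.coord k 0 * b.coord i 0 ≠ 0,
    fun i => b.coord i c - b.coord k c / b.coord k 0 * b.coord i 0, fun h => ?_, fun i => ?_,
    fun i => by simp, ?_⟩
  · have := h ▸ Finset.mem_univ k
    simp [(hpos k).ne'] at this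
  · exact sub_nonneg.2 ((le_div_iff₀ (hpos i)).1 (hk i))
  · simp only [sub_smul, mul_smul, Finset.sum_sub_distrib, ← Finset.smul_sum,
      b.linear_combination_coord_eq_self]
    simp

theorem AffineBasis.mem_dualBody_iff {x : EuclideanSpace ℝ (Fin d)} :
    x ∈ dualBody (convexHull ℝ (Set.range b)) ↔ ∀ i, inner ℝ x (b i) ≤ 1 := by
  have := b.nonempty
  refine ⟨fun h i => h _ (subset_convexHull ℝ _ ⟨i, rfl⟩), fun h y hy => ?_⟩
  obtain ⟨i, hi⟩ := maximizers_nonempty b x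
  rw [b.convexHull_eq_nonneg_coord] at hy
  have h₁ := b.inner_le_of_mem_maximizers hy hi
  rw [real_inner_comm, real_inner_comm x] at h₁
  exact h₁.trans (h i)

/-- The face of the dual of a simplex that corresponds to the face with vertex set `E`. -/
def dualFace (v : ι → EuclideanSpace ℝ (Fin d)) (E : Finset ι) :
    Set (EuclideanSpace ℝ (Fin d)) :=
  {x | (∀ i, inner ℝ x (v i) ≤ 1) ∧ ∀ i ∈ E, inner ℝ x (v i) = 1}

theorem AffineBasis.exists_dualFace_strict (hpos : ∀ i, 0 < b.coord i 0) {E : Finset ι}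
    (hE : E ≠ Finset.univ) :
    ∃ x ∈ dualFace b E, ∀ i, inner ℝ x (b i) = 1 ↔ i ∈ E := by
  classical
  obtain ⟨k, hk⟩ : ∃ k, k ∉ E := by
    by_contra! h
    exact hE (Finset.eq_univ_iff_forall.2 h)
  have hr : 0 < ∑ i ∈ Eᶜ, b.coord i 0 :=
    Finset.sum_pos (fun i _ => hpos i) ⟨k, Finset.mem_compl.2 hk⟩
  have hs : 0 ≤ ∑ i ∈ E, b.coord i 0 := Finset.sum_nonneg fun i _ => (hpos i).le
  -- With value `1` on `E`, this is the constant value off `E` dictated by the linear relation among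
  -- the vertices.
  set r := -((∑ i ∈ E, b.coord i 0) / ∑ i ∈ Eᶜ, b.coord i 0) with hrdef
  have hr0 : r ≤ 0 := neg_nonpos.2 (div_nonneg hs hr.le)
  obtain ⟨x, hx⟩ := b.exists_inner_eq (f := fun i => if i ∈ E then 1 else r) (by
    rw [← Finset.sum_add_sum_compl E]
    rw [Finset.sum_congr rfl (g := fun i => b.coord i 0) fun i hi => by simp [hi],
      Finset.sum_congr (s₁ := Eᶜ) rfl (g := fun i => b.coord i 0 * r)
        fun i hi => by simp [Finset.mem_compl.1 hi], ← Finset.sum_mul, hrdef]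
    field_simp
    ring)
  have hx' : ∀ i, inner ℝ x (b i) = if i ∈ E then 1 else r := fun i => by
    rw [real_inner_comm, hx]
  refine ⟨x, ⟨fun i => ?_, fun i hi => by simp [hx', hi]⟩, fun i => ?_⟩
  · rw [hx']
    split_ifs <;> linarith
  · rw [hx']
    split_ifs with h
    · simp [h]
    · simp only [h, iff_false]
      linarith

/-- Complementary slackness: the bound `∑ μ i` is attained, and only where every constraint with `μ
i ≠ 0` is tight. -/
theorem AffineBasis.supportFace_dualBody (hpos : ∀ i, 0 < b.coord i 0) {E : Finset ι}
    (hE : E ≠ Finset.univ) {μ : ι → ℝ} (h₀ : ∀ i, 0 ≤ μ i) (hμ : ∀ i, μ i ≠ 0 ↔ i ∈ E) :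
    supportFace (dualBody (convexHull ℝ (Set.range b))) (∑ i, μ i • b i) = dualFace b E := by
  obtain ⟨x₀, hx₀, -⟩ := b.exists_dualFace_strict hpos hE
  have hval : ∀ x ∈ dualFace b E, ∑ i, μ i * inner ℝ x (b i) = ∑ i, μ i := fun x hx => by
    refine Finset.sum_congr rfl fun i _ => ?_
    by_cases hi : i ∈ E
    · rw [hx.2 i hi, mul_one]
    · rw [not_not.1 (mt (hμ i).1 hi), zero_mul]
  ext x
  simp only [supportFace, Set.mem_ofPred_eq, b.mem_dualBody_iff, inner_sum, real_inner_smul_right]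
  constructor
  · rintro ⟨hx, h⟩
    refine ⟨hx, fun k hk => ?_⟩
    have h₁ := h x₀ hx₀.1
    rw [hval x₀ hx₀] at h₁
    have h₂ : ∑ i, μ i * (1 - inner ℝ x (b i)) ≤ 0 := by
      simp only [mul_sub, Finset.sum_sub_distrib, mul_one]
      linarith
    have h₃ : ∀ i ∈ Finset.univ, 0 ≤ μ i * (1 - inner ℝ x (b i)) :=
      fun i _ => mul_nonneg (h₀ i) (sub_nonneg.2 (hx i))
    have h₄ := (Finset.sum_eq_zero_iff_of_nonneg h₃).1 (le_antisymm h₂ (Finset.sum_nonneg h₃)) k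
      (Finset.mem_univ k)
    exact (sub_eq_zero.1 ((mul_eq_zero.1 h₄).resolve_left ((hμ k).2 hk))).symm
  · intro hx
    refine ⟨hx.1, fun y hy => ?_⟩
    rw [hval x hx]
    exact Finset.sum_le_sum fun i _ => mul_le_of_le_one_right (h₀ i) (hy i)

theorem AffineBasis.vectorSpan_dualFace (hpos : ∀ i, 0 < b.coord i 0) {E : Finset ι}
    (hE : E ≠ Finset.univ) :
    vectorSpan ℝ (dualFace b E) = (Submodule.span ℝ (b '' E))ᗮ := by
  have hmem : ∀ w, w ∈ (Submodule.span ℝ (b '' E))ᗮ ↔ ∀ i ∈ E, inner ℝ w (b i) = 0 := by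
    intro w
    rw [Submodule.mem_orthogonal']
    refine ⟨fun h i hi => h _ (Submodule.subset_span ⟨i, hi, rfl⟩), fun h u hu => ?_⟩
    induction hu using Submodule.span_induction with
    | mem x hx => obtain ⟨i, hi, rfl⟩ := hx; exact h i hi
    | zero => simp
    | add x y _ _ hx hy => simp [inner_add_right, hx, hy]
    | smul a x _ hx => simp [real_inner_smul_right, hx]
  apply le_antisymm
  · rw [vectorSpan_def, Submodule.span_le]
    rintro _ ⟨x, hx, y, hy, rfl⟩
    refine (hmem _).2 fun i hi => ?_
    change inner ℝ (x - y) (b i) = 0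
    rw [inner_sub_left, hx.2 i hi, hy.2 i hi, sub_self]
  · intro w hw
    rw [hmem] at hw
    obtain ⟨x, hx, hstrict⟩ := b.exists_dualFace_strict hpos hE
    -- The finitely many constraints off `E` are strict at `x`, so they survive a small move along
    -- `w`.
    have hev : ∀ᶠ t in nhds (0 : ℝ), ∀ i, i ∉ E → inner ℝ (x + t • w) (b i) < 1 := by
      refine Filter.eventually_all.2 fun i => ?_
      by_cases hi : i ∈ E
      · exact Filter.Eventually.of_forall fun _ h => absurd hi h
      · have hcont : Continuous fun t : ℝ => inner ℝ (x + t • w) (b i) := by fun_prop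
        have hlt : inner ℝ (x + (0 : ℝ) • w) (b i) < 1 := by
          rw [zero_smul, add_zero]
          exact lt_of_le_of_ne (hx.1 i) (mt (hstrict i).1 hi)
        exact (hcont.continuousAt.eventually_lt continuousAt_const hlt).mono fun _ h _ => h
    obtain ⟨t, ht, ht0⟩ := ((hev.filter_mono nhdsWithin_le_nhds).and
      (self_mem_nhdsWithin (a := (0 : ℝ)) (s := Set.Ioi 0))).exists
    have hon : ∀ i ∈ E, inner ℝ (x + t • w) (b i) = 1 := fun i hi => by
      rw [inner_add_left, real_inner_smul_left, hw i hi, hx.2 i hi, mul_zero, add_zero]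
    have hxt : x + t • w ∈ dualFace b E := by
      refine ⟨fun i => ?_, hon⟩
      by_cases hi : i ∈ E
      · exact (hon i hi).le
      · exact (ht i hi).le
    have := Submodule.smul_mem _ t⁻¹ (vsub_mem_vectorSpan ℝ hxt hx)
    simpa [smul_smul, (ne_of_gt ht0 : t ≠ 0)] using this

theorem AffineBasis.finrank_span_image (hpos : ∀ i, 0 < b.coord i 0) {E : Finset ι}
    (hE : E ≠ Finset.univ) : Module.finrank ℝ (Submodule.span ℝ (b '' E)) = E.card := by
  classical
  obtain ⟨k, hk⟩ : ∃ k, k ∉ E := by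
    by_contra! h
    exact hE (Finset.eq_univ_iff_forall.2 h)
  have hli : LinearIndependent ℝ (fun i : E => b i) := by
    refine Fintype.linearIndependent_iff.2 fun g hg j => ?_
    -- A functional isolating `b j` within `E`; its value at the omitted vertex `k` balances the
    -- linear relation.
    obtain ⟨c, hc⟩ := b.exists_inner_eq
      (f := fun i => if i = (j : ι) then 1 else if i = k then -(b.coord j 0 / b.coord k 0) else 0)
      (by
        have hjk : k ≠ (j : ι) := fun h => hk (h ▸ j.2)
        rw [Finset.sum_eq_add (j : ι) k hjk.symm]
        · simp only [if_true, hjk, if_false]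
          field_simp [(hpos k).ne']
          ring
        · rintro i - ⟨h₁, h₂⟩
          simp [h₁, h₂]
        · simp
        · simp)
    have := congrArg (fun x => inner ℝ x c) hg
    simp only [sum_inner, real_inner_smul_left, inner_zero_left, hc] at this
    rw [Finset.sum_eq_single j] at this
    · simpa using this
    · intro i _ hij
      have h₁ : (i : ι) ≠ j := fun h => hij (Subtype.ext h)
      have h₂ : (i : ι) ≠ k := fun h => hk (h ▸ i.2)
      simp [h₁, h₂]
    · simp
  have hr : b '' E = Set.range fun i : E => b i := by
    ext x
    simp
  rw [hr, finrank_span_eq_card hli, Fintype.card_coe]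

variable {α : ℝ}

/-- Since `A ⊆ E`, the direction of the simplex face lies in the span of `b '' E`, whose orthogonal
complement is the direction of the dual face. Dimensions therefore add. -/
theorem AffineBasis.finrank_vectorSpan_add_smul_dualFace (hpos : ∀ i, 0 < b.coord i 0)
    (hα : 0 < α) {A E : Finset ι} (hA : A.Nonempty) (hAE : A ⊆ E) (hE : E ≠ Finset.univ) :
    Module.finrank ℝ (vectorSpan ℝ (convexHull ℝ (b '' A) + α • dualFace b E)) + 1 + E.card
      = d + A.card := by
  classical
  have hne : (convexHull ℝ (b '' (A : Set ι))).Nonempty := by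
    obtain ⟨a, ha⟩ := hA
    exact ⟨b a, subset_convexHull ℝ _ ⟨a, ha, rfl⟩⟩
  obtain ⟨x, hx, -⟩ := b.exists_dualFace_strict hpos hE
  have hle : vectorSpan ℝ (b '' (A : Set ι)) ≤ Submodule.span ℝ (b '' (E : Set ι)) := by
    rw [vectorSpan_def, Submodule.span_le]
    rintro _ ⟨_, ⟨i, hi, rfl⟩, _, ⟨j, hj, rfl⟩, rfl⟩
    exact Submodule.sub_mem _ (Submodule.subset_span ⟨i, hAE hi, rfl⟩)
      (Submodule.subset_span ⟨j, hAE hj, rfl⟩)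
  have hinf : vectorSpan ℝ (b '' (A : Set ι)) ⊓ (Submodule.span ℝ (b '' (E : Set ι)))ᗮ = ⊥ :=
    eq_bot_iff.2 ((inf_le_inf_right _ hle).trans (Submodule.inf_orthogonal_eq_bot _).le)
  have h₁ := Submodule.finrank_sup_add_finrank_inf_eq (vectorSpan ℝ (b '' (A : Set ι)))
    (Submodule.span ℝ (b '' (E : Set ι)))ᗮ
  have h₂ := (Submodule.span ℝ (b '' (E : Set ι))).finrank_add_finrank_orthogonal
  have h₃ : Module.finrank ℝ (vectorSpan ℝ (b '' (A : Set ι))) = A.card - 1 := by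
    have := b.ind.finrank_vectorSpan_image_finset (s := A) (n := A.card - 1)
      (Nat.sub_add_cancel hA.card_pos).symm
    rwa [Finset.coe_image] at this
  rw [hinf, finrank_bot, h₃] at h₁
  rw [b.finrank_span_image hpos hE, finrank_euclideanSpace_fin] at h₂
  rw [vectorSpan_add_set hne ⟨_, Set.smul_mem_smul_set hx⟩, vectorSpan_smul_set hα.ne',
    vectorSpan_convexHull, b.vectorSpan_dualFace hpos hE]
  have := hA.card_pos
  omega

theorem AffineBasis.supportFace_nesterovRounding (hpos : ∀ i, 0 < b.coord i 0) (hα : 0 < α)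
    {E : Finset ι} (hE : E ≠ Finset.univ) {μ : ι → ℝ} (h₀ : ∀ i, 0 ≤ μ i)
    (hμ : ∀ i, μ i ≠ 0 ↔ i ∈ E) :
    supportFace (nesterovRounding α (convexHull ℝ (Set.range b))) (∑ i, μ i • b i) =
      convexHull ℝ (b '' maximizers b (∑ i, μ i • b i)) + α • dualFace b E := by
  rw [nesterovRounding, supportFace_add, supportFace_smul hα, b.supportFace_convexHull_range,
    b.supportFace_dualBody hpos hE h₀ hμ]

theorem AffineBasis.exists_supportFace_eq
    (hb : IsPerfectlyCentered (convexHull ℝ (Set.range b))) {A E : Finset ι} (hA : A.Nonempty)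
    (hAE : A ⊆ E) (hE : E ≠ Finset.univ) :
    ∃ c, supportFace (convexHull ℝ (Set.range b)) c = convexHull ℝ (b '' A) ∧
      supportFace (dualBody (convexHull ℝ (Set.range b))) c = dualFace b E := by
  classical
  have hpos := b.coord_zero_pos_of_isPerfectlyCentered hb
  obtain ⟨p, hp₀, hp, hpm⟩ := b.exists_center_of_isPerfectlyCentered hb hA
  obtain ⟨q, hq₀, hq, hqm⟩ := b.exists_center_of_isPerfectlyCentered hb (hA.mono hAE)
  -- The centers `p` of `A` and `q` of `E` have common maximizers `A ∩ E = A`, whereas the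
  -- coefficients of `p + q` have support `E`.
  have hmax : maximizers b (p + q) = A := by
    have := maximizers_smul_add b one_pos p q
      (by rwa [hpm, hqm, Finset.inter_eq_left.2 hAE])
    rwa [hpm, hqm, Finset.inter_eq_left.2 hAE, one_smul] at this
  refine ⟨p + q, by rw [b.supportFace_convexHull_range, hmax], ?_⟩
  have hsum : p + q = ∑ i, (b.coord i p + b.coord i q) • b i := by
    simp only [add_smul, Finset.sum_add_distrib, b.linear_combination_coord_eq_self]
  rw [hsum]
  refine b.supportFace_dualBody hpos hE (fun i => add_nonneg (hp₀ i) (hq₀ i)) fun i => ?_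
  rw [← hq i]
  constructor
  · intro h hqi
    have hpi : b.coord i p ≠ 0 := fun hpi => h (by rw [hpi, hqi, add_zero])
    exact (hq i).2 (hAE ((hp i).1 hpi)) hqi
  · intro h
    exact (add_pos_of_nonneg_of_pos (hp₀ i) (lt_of_le_of_ne (hq₀ i) h.symm)).ne'

theorem AffineBasis.eq_and_eq_of_add_smul_dualFace_eq
    (hb : IsPerfectlyCentered (convexHull ℝ (Set.range b))) (hα : 0 < α) {A E A' E' : Finset ι}
    (hA : A.Nonempty) (hAE : A ⊆ E) (hE : E ≠ Finset.univ)
    (hA' : A'.Nonempty) (hAE' : A' ⊆ E') (hE' : E' ≠ Finset.univ)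
    (h : convexHull ℝ (b '' A) + α • dualFace b E =
      convexHull ℝ (b '' A') + α • dualFace b E') : A ⊆ A' ∧ E' ⊆ E := by
  have hpos := b.coord_zero_pos_of_isPerfectlyCentered hb
  obtain ⟨c, hP, hD⟩ := b.exists_supportFace_eq hb hA hAE hE
  obtain ⟨c', hP', hD'⟩ := b.exists_supportFace_eq hb hA' hAE' hE'
  obtain ⟨x, hx, hx'⟩ := b.exists_dualFace_strict hpos hE
  have key := supportFace_eq_of_supportFace_add_eq
    (P := convexHull ℝ (Set.range b)) (Q := α • dualBody (convexHull ℝ (Set.range b)))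
    (c := c) (c' := c')
    (by
      obtain ⟨a, ha⟩ := hA
      exact ⟨b a, hP ▸ subset_convexHull ℝ _ ⟨a, ha, rfl⟩⟩)
    (by
      rw [supportFace_smul hα, hD]
      exact ⟨_, Set.smul_mem_smul_set hx⟩)
    (by
      rw [supportFace_add, supportFace_add, supportFace_smul hα, supportFace_smul hα, hP, hD,
        hP', hD', h])
  rw [supportFace_smul hα, supportFace_smul hα, hP, hP', hD, hD'] at key
  refine ⟨fun i hi => ?_, fun i hi => ?_⟩
  · rw [← b.mem_convexHull_image_apply_iff]
    exact key.1 ((b.mem_convexHull_image_apply_iff A i).2 hi)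
  · have hxE' : x ∈ dualFace b E' :=
      (Set.smul_mem_smul_set_iff₀ hα.ne' _ _).1 (key.2 (Set.smul_mem_smul_set hx))
    exact (hx' i).1 (hxE'.2 i hi)

/-- Handles `c = 0`, the case of empty `E`: the resulting face is the whole body, excluded by `k <
d`. -/
theorem AffineBasis.finrank_vectorSpan_nesterovRounding :
    Module.finrank ℝ (vectorSpan ℝ (nesterovRounding α (convexHull ℝ (Set.range b)))) = d := by
  have := b.nonempty
  have h0 : (0 : EuclideanSpace ℝ (Fin d)) ∈ dualBody (convexHull ℝ (Set.range b)) :=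
    b.mem_dualBody_iff.2 fun i => by simp
  have hD : (α • dualBody (convexHull ℝ (Set.range b))).Nonempty :=
    ⟨_, Set.smul_mem_smul_set h0⟩
  rw [nesterovRounding, vectorSpan_add_set (Set.range_nonempty b).convexHull hD,
    vectorSpan_convexHull, AffineSubspace.vectorSpan_eq_top_of_affineSpan_eq_top ℝ _ _ b.tot,
    top_sup_eq,
    finrank_top, finrank_euclideanSpace_fin]

end Centered

/-! ### Counting the faces. -/

theorem AffineBasis.faceCount_nesterovRounding {d : ℕ}
    (b : AffineBasis (Fin (d + 1)) ℝ (EuclideanSpace ℝ (Fin d)))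
    (hb : IsPerfectlyCentered (convexHull ℝ (Set.range b))) {α : ℝ} (hα : 0 < α) {k : ℕ}
    (hk : k < d) :
    faceCount k (nesterovRounding α (convexHull ℝ (Set.range b))) =
      (d + 1).choose (k + 2) * (2 ^ (k + 2) - 2) := by
  have hpos := b.coord_zero_pos_of_isPerfectlyCentered hb
  -- Elements are pairs `⟨C, A⟩`; the associated `E` is `A ∪ Cᶜ`, proper because `A ≠ C`.
  let T : Finset (Σ _ : Finset (Fin (d + 1)), Finset (Fin (d + 1))) :=
    (Finset.powersetCard (k + 2) Finset.univ).sigma fun C => C.ssubsets.erase ∅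
  let Φ : (Σ _ : Finset (Fin (d + 1)), Finset (Fin (d + 1))) → Set (EuclideanSpace ℝ (Fin d)) :=
    fun s => convexHull ℝ (b '' s.2) + α • dualFace b (s.2 ∪ s.1ᶜ)
  have hT : ∀ s, s ∈ T ↔ s.1.card = k + 2 ∧ s.2.Nonempty ∧ s.2 ⊂ s.1 := by
    intro s
    simp [T, Finset.nonempty_iff_ne_empty]
  have hproper : ∀ s ∈ T, s.2 ∪ s.1ᶜ ≠ Finset.univ := by
    intro s hs h
    obtain ⟨x, hx, hx'⟩ := Finset.exists_of_ssubset ((hT s).1 hs).2.2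
    have := h ▸ Finset.mem_univ x
    simp [hx, hx'] at this
  have hcard : T.card = (d + 1).choose (k + 2) * (2 ^ (k + 2) - 2) := by
    rw [Finset.card_sigma, Finset.sum_congr rfl (g := fun _ => 2 ^ (k + 2) - 2),
      Finset.sum_const, Finset.card_powersetCard, Finset.card_univ, Fintype.card_fin, smul_eq_mul]
    intro C hC
    have hC' := (Finset.mem_powersetCard.1 hC).2
    rw [Finset.card_erase_of_mem, Finset.ssubsets,
      Finset.card_erase_of_mem (Finset.mem_powerset_self C), Finset.card_powerset, hC']
    · omega
    · refine Finset.empty_mem_ssubsets (Finset.card_pos.1 ?_)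
      omega
  have hinj : Set.InjOn Φ T := by
    intro s hs s' hs' h
    have h₁ := (hT s).1 hs
    have h₂ := (hT s').1 hs'
    have e₁ := b.eq_and_eq_of_add_smul_dualFace_eq hb hα h₁.2.1 Finset.subset_union_left
      (hproper s hs) h₂.2.1 Finset.subset_union_left (hproper s' hs') h
    have e₂ := b.eq_and_eq_of_add_smul_dualFace_eq hb hα h₂.2.1 Finset.subset_union_left
      (hproper s' hs') h₁.2.1 Finset.subset_union_left (hproper s hs) h.symm
    have eA : s.2 = s'.2 := e₁.1.antisymm e₂.1
    have eE : s.2 ∪ s.1ᶜ = s'.2 ∪ s'.1ᶜ := e₂.2.antisymm e₁.2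
    have hrec : ∀ s ∈ T, s.1 = s.2 ∪ (s.2 ∪ s.1ᶜ)ᶜ := by
      intro s hs
      have := ((hT s).1 hs).2.2.subset
      ext x
      have := @this x
      simp only [Finset.mem_union, Finset.mem_compl]
      tauto
    have eC : s.1 = s'.1 := by rw [hrec s hs, hrec s' hs', eE, eA]
    exact Sigma.ext eC (heq_of_eq eA)
  rw [← hcard, ← Set.ncard_coe_finset, ← hinj.ncard_image, faceCount]
  congr 1
  ext F
  constructor
  · rintro ⟨⟨-, c, rfl⟩, hdim⟩
    obtain ⟨E, μ, hE, h₀, hμ, rfl⟩ := b.exists_conic_combination hpos c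
    by_cases hne : E.Nonempty
    · have hAE := b.maximizers_sum_smul_subset hb E hne μ h₀ hμ
      rw [b.supportFace_nesterovRounding hpos hα hE h₀ hμ] at hdim ⊢
      set A := maximizers b (∑ i, μ i • b i) with hA
      have hAne : A.Nonempty := maximizers_nonempty b _
      have hdim' := b.finrank_vectorSpan_add_smul_dualFace hpos hα hAne hAE hE
      have hdisj : Disjoint A Eᶜ :=
        Finset.disjoint_left.2 fun i hi hi' => Finset.mem_compl.1 hi' (hAE hi)
      have hEc := Finset.card_add_card_compl E
      have hlt : 0 < Eᶜ.card := Finset.card_pos.2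
        (Finset.nonempty_iff_ne_empty.2 fun h => hE (Finset.compl_eq_empty_iff E |>.1 h))
      rw [Fintype.card_fin] at hEc
      refine ⟨⟨A ∪ Eᶜ, A⟩, (hT _).2 ⟨?_, hAne, ?_⟩, ?_⟩
      · change (A ∪ Eᶜ).card = _
        rw [Finset.card_union_of_disjoint hdisj]
        omega
      · refine Finset.ssubset_iff_subset_ne.2 ⟨Finset.subset_union_left, fun h => ?_⟩
        have := congrArg Finset.card h
        change A.card = (A ∪ Eᶜ).card at this
        rw [Finset.card_union_of_disjoint hdisj] at this
        omega
      · have : A ∪ (A ∪ Eᶜ)ᶜ = E := by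
          ext x
          have := @hAE x
          simp only [Finset.mem_union, Finset.mem_compl]
          tauto
        simp only [Φ, this]
    · have hz : ∑ i, μ i • b i = 0 := Finset.sum_eq_zero fun i _ => by
        have : μ i = 0 := by
          by_contra h
          exact hne ⟨i, (hμ i).1 h⟩
        rw [this, zero_smul]
      have hzero : supportFace (nesterovRounding α (convexHull ℝ (Set.range b))) 0 =
          nesterovRounding α (convexHull ℝ (Set.range b)) := by
        simp [supportFace]
      rw [hz, hzero, b.finrank_vectorSpan_nesterovRounding] at hdim
      omega
  · rintro ⟨s, hs, rfl⟩
    have h := (hT s).1 hs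
    have hE := hproper s hs
    refine ⟨⟨?_, ?_⟩, ?_⟩
    · obtain ⟨a, ha⟩ := h.2.1
      obtain ⟨x, hx, -⟩ := b.exists_dualFace_strict hpos hE
      exact ⟨_, Set.add_mem_add (subset_convexHull ℝ _ ⟨a, ha, rfl⟩) (Set.smul_mem_smul_set hx)⟩
    · obtain ⟨c, hP, hD⟩ := b.exists_supportFace_eq hb h.2.1 Finset.subset_union_left hE
      exact ⟨c, by rw [nesterovRounding, supportFace_add, supportFace_smul hα, hP, hD]⟩
    · have hdim := b.finrank_vectorSpan_add_smul_dualFace hpos hα h.2.1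
        Finset.subset_union_left hE
      have hdisj : Disjoint s.2 s.1ᶜ :=
        Finset.disjoint_left.2 fun i hi hi' => Finset.mem_compl.1 hi' (h.2.2.subset hi)
      have hc := Finset.card_add_card_compl s.1
      rw [Fintype.card_fin] at hc
      rw [Finset.card_union_of_disjoint hdisj] at hdim
      change Module.finrank ℝ (vectorSpan ℝ
        (convexHull ℝ (b '' s.2) + α • dualFace b (s.2 ∪ s.1ᶜ))) = k
      omega

theorem mainTheorem6 (d : ℕ) (Δ : Affine.Simplex ℝ (EuclideanSpace ℝ (Fin d)) d)
    (hΔ : IsPerfectlyCentered (convexHull ℝ (Set.range Δ.points)))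
    (α : ℝ) (hα : 0 < α) (k : ℕ) (hk : k < d) :
    faceCount k (nesterovRounding α (convexHull ℝ (Set.range Δ.points))) =
      (d + 1).choose (k + 2) * (2 ^ (k + 2) - 2) :=
  AffineBasis.faceCount_nesterovRounding
    ⟨Δ.points, Δ.independent, Δ.span_eq_top (by simp)⟩ hΔ hα hk
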